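/- **Conventions.** A *normal pair* $(N,F)$ is a group $F$ with a normal subgroup $N$. For a group $F$ let $U_F$ be the free group on the symbols $u_x$, $x\in F\setminus\{1\}$ (and put $u_1=1$), and let $J_F$ be the kernel of the evaluation map $U_F\to F$, $u_x\mapsto x$. For a normal pair $(N,F)$ let $U_{N,F}$ be the kernel of the map $U_F\to U_{F/N}$, $u_x\mapsto u_{xN}$, and let $J_{N,F}=U_{N,F}\cap J_F$, which is normal in $U_F$. The *$J$-suspension* of $(N,F)$ is the normal pair $(J_{N,F},U_F)$; its second $J$-suspension is $(J^2_{N,F},U^2_F)$ with $U^2_F=U_{U_F}$ and $J^2_{N,F}=J_{J_{N,F},\,U_F}$. An *$F$-central extension* of $N$ is a group $\overline N$ with an action of $F$ by automorphisms and a surjective homomorphism $p:\overline N\to N$ that is $F$-equivariant (where $F$ acts on $N$ by conjugation), such that $xyx^{-1}=p(x)\cdot y$ for all $x,y\in\overline N$ and $F$ acts trivially on $\ker p$ (hence $\ker p$ is central). Let $[\overline N,F]$ be the subgroup of $\overline N$ generated by all $(f\cdot x)x^{-1}$ with $f\in F$, $x\in\overline N$. The extension is *semiuniversal* if for every $F$-central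 extension $\overline N'$ of $N$ there is an $F$-equivariant homomorphism $\overline N\to\overline N'$ over the identity of $N$, and any two such homomorphisms agree on $[\overline N,F]$. The pair $(N,F)$ is *admissible* if $N$ has a semiuniversal $F$-central extension $\overline N$ whose kernel $\ker(\overline N\to N)$ is contained in $[\overline N,F]$. **Lemma 14 (Suspension Lemma).** Let $(R,U)$ be a normal pair such that $R$ is a free group. Then its $J$-suspension $(J_{R,U},U_U)$ is admissible. In particular, for any normal pair $(N,F)$ the second $J$-suspension $(J^2_{N,F},U^2_F)$ is admissible. -/

import Mathlib

universe u v w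

/-- The free group `U_F` with one free generator `u_x` for every `x ∈ F`, `x ≠ 1`
(so that `u_1 = 1`). -/
abbrev UGroup (F : Type u) [Group F] : Type u := FreeGroup {x : F // x ≠ 1}

namespace UGroup

open Classical in
/-- The element `u_x` of `U_F`; by convention `u_1 = 1`. -/
noncomputable def gen {F : Type u} [Group F] (x : F) : UGroup F :=
  if h : x = 1 then 1 else FreeGroup.of ⟨x, h⟩

/-- The evaluation map `U_F → F`, `u_x ↦ x`. -/
def eval (F : Type u) [Group F] : UGroup F →* F :=
  FreeGroup.lift (fun x : {x : F // x ≠ 1} => (x : F))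

/-- The homomorphism `U_F → U_G`, `u_x ↦ u_{φ x}`, induced by `φ : F → G`. -/
noncomputable def map {F : Type u} {G : Type v} [Group F] [Group G] (φ : F →* G) :
    UGroup F →* UGroup G :=
  FreeGroup.lift (fun x : {x : F // x ≠ 1} => gen (φ x))

end UGroup

/-- `J_F`, the kernel of the evaluation map `U_F → F`. -/
def JFull (F : Type u) [Group F] : Subgroup (UGroup F) := (UGroup.eval F).ker

/-- `U_{N,F}`, the kernel of the induced map `U_F → U_{F/N}`. -/
noncomputable def UPair {F : Type u} [Group F] (N : Subgroup F) [N.Normal] :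
    Subgroup (UGroup F) := (UGroup.map (QuotientGroup.mk' N)).ker

/-- `J_{N,F} = U_{N,F} ∩ J_F`, the kernel of the evaluation map `U_{N,F} → N`.
The `J`-suspension of the normal pair `(N, F)` is the normal pair `(J_{N,F}, U_F)`. -/
noncomputable def JPair {F : Type u} [Group F] (N : Subgroup F) [N.Normal] :
    Subgroup (UGroup F) := UPair N ⊓ JFull F

instance JPair.normal {F : Type u} [Group F] (N : Subgroup F) [N.Normal] :
    (JPair N).Normal := by
  unfold JPair UPair JFull
  infer_instance

/-- An `F`-central extension `1 → C → E → N → 1` of a normal subgroup `N` of `F`: a group `E` on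
which `F` acts by automorphisms, with an equivariant surjection onto `N` (`F` acting on `N` by
conjugation), such that `N ≤ F` acts on `E` through inner automorphisms (the conjugation by an
element of `E` is the action of its image in `N`), and `F` acts trivially on the kernel `C`.
The kernel is then central in `E`, see `FCentralExtension.ker_le_center`. -/
structure FCentralExtension {F : Type u} [Group F] (N : Subgroup F) [N.Normal] where
  /-- The underlying group `E`. -/
  carrier : Type v
  [group : Group carrier]
  [action : MulDistribMulAction F carrier]
  /-- The projection `E → N`. -/
  proj : carrier →* N
  surjective : Function.Surjective proj
  equivariant : ∀ (f : F) (x : carrier), ((proj (f • x) : N) : F) = f * (proj x : F) * f⁻¹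
  conj_eq : ∀ x y : carrier, x * y * x⁻¹ = (proj x : F) • y
  smul_ker : ∀ (f : F) (x : carrier), x ∈ proj.ker → f • x = x

namespace FCentralExtension

attribute [instance] FCentralExtension.group FCentralExtension.action

variable {F : Type u} [Group F] {N : Subgroup F} [N.Normal]

theorem ker_le_center (E : FCentralExtension.{u, v} N) :
    E.proj.ker ≤ Subgroup.center E.carrier := by
  intro x hx
  rw [Subgroup.mem_center_iff]
  intro y
  have h := E.conj_eq x y
  rw [MonoidHom.mem_ker.mp hx, Subgroup.coe_one, one_smul] at h
  exact (mul_inv_eq_iff_eq_mul.mp h).symm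

/-- A morphism of `F`-central extensions of `N`: an `F`-equivariant homomorphism over the
identity of `N`. -/
structure Hom (E : FCentralExtension.{u, v} N) (E' : FCentralExtension.{u, w} N) where
  /-- The underlying homomorphism. -/
  toHom : E.carrier →* E'.carrier
  proj_comp : ∀ x : E.carrier, E'.proj (toHom x) = E.proj x
  map_smul : ∀ (f : F) (x : E.carrier), toHom (f • x) = f • toHom x

/-- The commutator subgroup `[E, F]`, generated by all `(f • x) x⁻¹`. -/
def commutator (E : FCentralExtension.{u, v} N) : Subgroup E.carrier :=
  Subgroup.closure {z | ∃ (f : F) (x : E.carrier), z = (f • x) * x⁻¹}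

/-- `E` is semiuniversal: it maps to every `F`-central extension of `N`, and the map is uniquely
determined on the commutator subgroup `[E, F]`. -/
def IsSemiuniversal (E : FCentralExtension.{u, v} N) : Prop :=
  ∀ E' : FCentralExtension.{u, w} N,
    Nonempty (E.Hom E') ∧
      ∀ φ ψ : E.Hom E', ∀ x ∈ E.commutator, φ.toHom x = ψ.toHom x

end FCentralExtension

/-- The normal pair `(N, F)` is admissible: `N` has a semiuniversal `F`-central extension `E`
whose central kernel is contained in `[E, F]`. The universe `w` is that of the extensions to which
`E` is compared. -/
def IsAdmissible {F : Type u} [Group F] (N : Subgroup F) [N.Normal] : Prop :=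
  ∃ E : FCentralExtension.{u, u} N,
    FCentralExtension.IsSemiuniversal.{u, u, w} E ∧ E.proj.ker ≤ E.commutator

/-!
Let `R` be free. The quotient `Q` of `U_U` by `J_{R,U}` is an extension of the free group `U_{U/R}`
by the free group `U_{R,U} / J_{R,U} ≅ R`. It has cohomological dimension at most two, so the
obstruction in `H³(Q, C)` to splitting a central extension of `J_{R,U}` with kernel `C` vanishes.
The splitting can be built without cohomology. An `F`-central extension `E` of `N` is enlarged to a
group `T ⊇ E` over a larger subgroup of `F`, one semidirect product with a free group at a time,
until `T` covers `F`. If `F` is free as well, then `T → F` has a section, and the section maps `N`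
to `E`. Hence `N` is semiuniversal as an extension of itself, and its kernel is trivial.
-/

theorem exists_comp_eq_of_isFreeGroup_of_range_le {G H K : Type*} [Group G] [Group H] [Group K]
    [IsFreeGroup G] (f : G →* H) (p : K →* H) (h : f.range ≤ p.range) :
    ∃ g : G →* K, p.comp g = f := by
  choose t ht using fun x => h ⟨x, rfl⟩
  exact ⟨IsFreeGroup.lift fun a => t (IsFreeGroup.of a), IsFreeGroup.ext_hom fun a => by simp [ht]⟩

theorem exists_comp_eq_of_isFreeGroup {G H K : Type*} [Group G] [Group H] [Group K] [IsFreeGroup G]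
    {p : K →* H} (hp : Function.Surjective p) (f : G →* H) :
    ∃ g : G →* K, p.comp g = f :=
  exists_comp_eq_of_isFreeGroup_of_range_le f p (MonoidHom.range_eq_top.2 hp ▸ le_top)

theorem exists_rightInverse_of_isFreeGroup {G H : Type*} [Group G] [Group H] [IsFreeGroup H]
    {p : G →* H} (hp : Function.Surjective p) :
    ∃ s : H →* G, Function.RightInverse s p :=
  (exists_comp_eq_of_isFreeGroup hp (MonoidHom.id H)).imp fun _ => DFunLike.congr_fun

section Splitting

variable {A T Q H : Type*} [Group A] [Group T] [Group Q] [Group H] {S : GroupExtension A T Q}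

theorem exists_monoidHom_of_splitting (s : S.Splitting) (a : A →* H) (r : Q →* H)
    (h : ∀ q n, a (s.conjAct q n) = r q * a n * (r q)⁻¹) :
    ∃ g : T →* H, (∀ n, g (S.inl n) = a n) ∧ ∀ q, g (s q) = r q := by
  let g := SemidirectProduct.lift a r fun q => MonoidHom.ext (h q)
  let e := s.semidirectProductMulEquiv
  have inl_eq (n : A) : S.inl n = e (.inl n) :=
    (congrFun s.semidirectProductToGroupExtensionEquiv.inl_comm n).symm
  have splitting_eq (q : Q) : s q = e (.inr q) := by
    change s q = S.inl 1 * s q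
    rw [map_one, one_mul]
  refine ⟨g.comp e.symm.toMonoidHom, fun n => ?_, fun q => ?_⟩
  · simp [inl_eq, g]
  · simp [splitting_eq, g]

theorem monoidHom_ext_of_splitting (s : S.Splitting) {f g : T →* H}
    (h_inl : ∀ n, f (S.inl n) = g (S.inl n)) (h_splitting : ∀ q, f (s q) = g (s q)) : f = g := by
  ext t
  obtain ⟨⟨n, q⟩, rfl⟩ := s.semidirectProductMulEquiv.surjective t
  change f (S.inl n * s q) = g (S.inl n * s q)
  rw [map_mul, map_mul, h_inl, h_splitting]

end Splitting

namespace FCentralExtension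

variable {F : Type u} [Group F] {N : Subgroup F} [N.Normal]

theorem Hom.eqOn_commutator {E : FCentralExtension.{u, v} N} {E' : FCentralExtension.{u, w} N}
    (φ ψ : E.Hom E') : Set.EqOn φ.toHom ψ.toHom E.commutator := by
  change E.commutator ≤ φ.toHom.eqLocus ψ.toHom
  rw [commutator, Subgroup.closure_le]
  rintro _ ⟨f, x, rfl⟩
  change φ.toHom (f • x * x⁻¹) = ψ.toHom (f • x * x⁻¹)
  -- `φ` and `ψ` differ by elements of the kernel of `E'`, on which `F` acts trivially.
  have hker : ψ.toHom x⁻¹ * φ.toHom x ∈ E'.proj.ker := by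
    rw [MonoidHom.mem_ker, map_mul, φ.proj_comp, ψ.proj_comp, ← map_mul, inv_mul_cancel, map_one]
  have hfix := E'.smul_ker f _ hker
  rw [smul_mul', ← ψ.map_smul, ← φ.map_smul, smul_inv', map_inv, map_inv, inv_mul_eq_iff_eq_mul,
    ← mul_assoc] at hfix
  rw [map_mul, map_mul, map_inv, map_inv, hfix]
  group

/-- The normal subgroup `N`, with the conjugation action, as an `F`-central extension of itself. -/
def self (N : Subgroup F) [N.Normal] : FCentralExtension.{u, u} N where
  carrier := N
  action := MulDistribMulAction.compHom (M := MulAut N) N (MulAut.conjNormal : F →* MulAut N)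
  proj := MonoidHom.id N
  surjective := Function.surjective_id
  equivariant f x := MulAut.conjNormal_apply f x
  conj_eq x y := Subtype.ext (MulAut.conjNormal_apply (x : F) y).symm
  smul_ker f x hx := by
    obtain rfl : x = 1 := hx
    exact map_one (MulAut.conjNormal f)

theorem isAdmissible_of_nonempty_self_hom
    (h : ∀ E : FCentralExtension.{u, w} N, Nonempty ((self N).Hom E)) : IsAdmissible.{u, w} N := by
  refine ⟨self N, fun E => ⟨h E, Hom.eqOn_commutator⟩, ?_⟩
  rintro x rfl
  exact one_mem _

/-- A thickening of `E` over `M` is a group with a surjection onto `M` that contains `E` as the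
preimage of `N` and acts on `E` by conjugation through the given action of `F`. Equivalently, it is
an extension of `M / N` by `E` that induces the given action of `M` on `E`. -/
structure Thickening (E : FCentralExtension.{u, v} N) (M : Subgroup F) where
  /-- The underlying group. -/
  carrier : Type w
  [group : Group carrier]
  /-- The inclusion of `E`. -/
  incl : E.carrier →* carrier
  /-- The projection to `M`. -/
  proj : carrier →* M
  incl_injective : Function.Injective incl
  proj_surjective : Function.Surjective proj
  proj_incl : ∀ e, (proj (incl e) : F) = E.proj e
  mem_range_incl : ∀ t, (proj t : F) ∈ N → t ∈ incl.range
  conj_incl : ∀ t e, t * incl e * t⁻¹ = incl ((proj t : F) • e)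

namespace Thickening

attribute [instance] Thickening.group

variable {E : FCentralExtension.{u, v} N} {M : Subgroup F}

theorem le (T : Thickening E M) : N ≤ M := fun n hn => by
  obtain ⟨e, he⟩ := E.surjective ⟨n, hn⟩
  have hproj : (T.proj (T.incl e) : F) = n := (T.proj_incl e).trans (congrArg Subtype.val he)
  exact hproj ▸ (T.proj (T.incl e)).2

/-- A thickening over `M` as an extension of `M / N` by `E`. -/
def toGroupExtension (T : Thickening E M) :
    GroupExtension E.carrier T.carrier (M ⧸ N.subgroupOf M) where
  inl := T.incl
  rightHom := (QuotientGroup.mk' _).comp T.proj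
  inl_injective := T.incl_injective
  range_inl_eq_ker_rightHom := by
    ext t
    rw [MonoidHom.mem_ker, MonoidHom.comp_apply, QuotientGroup.mk'_apply, QuotientGroup.eq_one_iff,
      Subgroup.mem_subgroupOf]
    refine ⟨?_, T.mem_range_incl t⟩
    rintro ⟨e, rfl⟩
    exact (T.proj_incl e).symm ▸ (E.proj e).2
  rightHom_surjective := (QuotientGroup.mk'_surjective _).comp T.proj_surjective

/-- The self-map `α` of a thickening covers the conjugation by `f` and extends the action of
`f` on `E`. -/
structure LiftsConj (T : Thickening E M) (f : F) (α : T.carrier → T.carrier) : Prop where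
  proj_apply : ∀ t, (T.proj (α t) : F) = f * T.proj t * f⁻¹
  apply_incl : ∀ e, α (T.incl e) = T.incl (f • e)

namespace LiftsConj

variable {T : Thickening E M} {f : F} {α : T.carrier →* T.carrier}

theorem apply_eq_self (hα : T.LiftsConj f α) {t : T.carrier} (ht : T.proj t = 1) : α t = t := by
  have ht' : (T.proj t : F) = 1 := congrArg Subtype.val ht
  obtain ⟨e, rfl⟩ := T.mem_range_incl t (ht' ▸ N.one_mem)
  rw [hα.apply_incl, E.smul_ker]
  exact Subtype.ext ((T.proj_incl e).symm.trans ht')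

theorem bijective [M.Normal] (hα : T.LiftsConj f α) : Function.Bijective α := by
  have proj_apply (t) : T.proj (α t) = MulAut.conjNormal f (T.proj t) :=
    Subtype.ext (hα.proj_apply t)
  constructor
  · refine (injective_iff_map_eq_one α).2 fun t ht => ?_
    have hker : T.proj t = 1 := by
      rw [← EmbeddingLike.map_eq_one_iff (f := MulAut.conjNormal f), ← proj_apply, ht, map_one]
    rw [← hα.apply_eq_self hker, ht]
  · intro t
    obtain ⟨s, hs⟩ := T.proj_surjective ((MulAut.conjNormal f).symm (T.proj t))
    have hker : T.proj ((α s)⁻¹ * t) = 1 := by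
      rw [map_mul, map_inv, proj_apply, hs, MulEquiv.apply_symm_apply, inv_mul_cancel]
    exact ⟨s * ((α s)⁻¹ * t), by rw [map_mul, hα.apply_eq_self hker, mul_inv_cancel_left]⟩

end LiftsConj

theorem exists_liftsConj (T : Thickening E M) [M.Normal] [IsFreeGroup (M ⧸ N.subgroupOf M)]
    (f : F) : ∃ α : MulAut T.carrier, T.LiftsConj f α := by
  obtain ⟨s, hs⟩ := exists_rightInverse_of_isFreeGroup T.toGroupExtension.rightHom_surjective
  let S : T.toGroupExtension.Splitting := ⟨s, hs⟩
  obtain ⟨l, hl⟩ := exists_comp_eq_of_isFreeGroup T.proj_surjective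
    ((MulAut.conjNormal f).toMonoidHom.comp (T.proj.comp s))
  have proj_l (q) : T.proj (l q) = MulAut.conjNormal f (T.proj (s q)) := DFunLike.congr_fun hl q
  -- `T` is generated by `E` and the image of `s`; on these, `α` is the action of `f` and `l`.
  obtain ⟨α, α_incl, α_s⟩ := exists_monoidHom_of_splitting S
    (T.incl.comp (MulDistribMulAction.toMonoidHom E.carrier f)) l fun q e => by
      have conjAct_apply : S.conjAct q e = (T.proj (s q) : F) • e := T.incl_injective <| by
        rw [← T.conj_incl]
        exact T.toGroupExtension.inl_conjAct_comm
      simp only [conjAct_apply, MonoidHom.comp_apply, MulDistribMulAction.toMonoidHom_apply,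
        T.conj_incl, proj_l, MulAut.conjNormal_apply, smul_smul, inv_mul_cancel_right]
  have hproj : T.proj.comp α = (MulAut.conjNormal f).toMonoidHom.comp T.proj := by
    refine monoidHom_ext_of_splitting S (fun e => Subtype.ext ?_) fun q => ?_
    · change (T.proj (α (T.incl e)) : F) = f * T.proj (T.incl e) * f⁻¹
      rw [show α (T.incl e) = T.incl (f • e) from α_incl e, T.proj_incl, T.proj_incl, E.equivariant]
    · exact (congrArg T.proj (α_s q)).trans (proj_l q)
  have hα : T.LiftsConj f α := ⟨fun t => congrArg Subtype.val (DFunLike.congr_fun hproj t), α_incl⟩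
  exact ⟨MulEquiv.ofBijective α hα.bijective, hα⟩

/-- The group of pairs `(α, f)` of an automorphism `α` of a thickening and an element `f` such that
`α` lifts the conjugation by `f`. The element is recorded because `α` does not determine it. -/
def conjLifts (T : Thickening E M) : Subgroup (MulAut T.carrier × F) where
  carrier := {x | T.LiftsConj x.2 x.1}
  one_mem' := ⟨by simp, by simp⟩
  mul_mem' {x y} hx hy :=
    ⟨fun t => by simp [hx.proj_apply, hy.proj_apply, mul_assoc],
      fun e => by simp [hx.apply_incl, hy.apply_incl, mul_smul]⟩
  inv_mem' {x} hx :=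
    ⟨fun t => by
      have := hx.proj_apply (x.1⁻¹ t)
      rw [MulAut.apply_inv_self] at this
      simp [this, mul_assoc],
    fun e => x.1.injective <| by simp [hx.apply_incl]⟩

theorem exists_liftsConj_monoidHom (T : Thickening E M) {W : Type*} [Group W] [IsFreeGroup W]
    (τ : W →* F) (h : ∀ w, ∃ α : MulAut T.carrier, T.LiftsConj (τ w) α) :
    ∃ β : W →* MulAut T.carrier, ∀ w, T.LiftsConj (τ w) (β w) := by
  obtain ⟨g, hg⟩ := exists_comp_eq_of_isFreeGroup_of_range_le τ
    ((MonoidHom.snd (MulAut T.carrier) F).comp T.conjLifts.subtype) (by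
      rintro _ ⟨w, rfl⟩
      obtain ⟨α, hα⟩ := h w
      exact ⟨⟨(α, τ w), hα⟩, rfl⟩)
  refine ⟨(MonoidHom.fst _ _).comp (T.conjLifts.subtype.comp g), fun w => ?_⟩
  rw [← hg]
  exact (g w).2

/-- A central extension is a thickening of itself. -/
def refl (E : FCentralExtension.{u, v} N) : Thickening.{u, v, v} E N where
  carrier := E.carrier
  incl := MonoidHom.id _
  proj := E.proj
  incl_injective := Function.injective_id
  proj_surjective := E.surjective
  proj_incl _ := rfl
  mem_range_incl t _ := ⟨t, rfl⟩
  conj_incl := E.conj_eq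

theorem liftsConj_refl (E : FCentralExtension.{u, v} N) (f : F) :
    (refl E).LiftsConj f (MulDistribMulAction.toMulAut F E.carrier f) :=
  ⟨E.equivariant f, fun _ => rfl⟩

/-- The semidirect product of a thickening over `M` with `M' / M`, which acts through lifts of the
conjugations by the values of a section `σ` of `M' → M' / M`. -/
def semidirect (T : Thickening.{u, v, w} E M) [M.Normal] {M' : Subgroup F} (hM : M ≤ M')
    {σ : M' ⧸ M.subgroupOf M' →* M'} (hσ : ∀ q, QuotientGroup.mk (σ q) = q)
    {β : M' ⧸ M.subgroupOf M' →* MulAut T.carrier}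
    (hβ : ∀ q, T.LiftsConj (σ q) (β q)) :
    Thickening.{u, v, max w u} E M' where
  carrier := T.carrier ⋊[β] (M' ⧸ M.subgroupOf M')
  incl := SemidirectProduct.inl.comp T.incl
  proj := SemidirectProduct.lift ((Subgroup.inclusion hM).comp T.proj) σ fun q =>
    MonoidHom.ext fun t => Subtype.ext ((hβ q).proj_apply t)
  incl_injective := SemidirectProduct.inl_injective.comp T.incl_injective
  proj_surjective m := by
    have hm : m * (σ m)⁻¹ ∈ M.subgroupOf M' := by
      rw [← QuotientGroup.eq_one_iff, QuotientGroup.mk_mul, QuotientGroup.mk_inv, hσ,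
        mul_inv_cancel]
    obtain ⟨t, ht⟩ := T.proj_surjective ⟨m * (σ m)⁻¹, hm⟩
    refine ⟨⟨t, m⟩, ?_⟩
    change Subgroup.inclusion hM (T.proj t) * σ m = m
    rw [ht]
    exact inv_mul_cancel_right m (σ m)
  proj_incl e := by simp [T.proj_incl]
  mem_range_incl := by
    rintro ⟨t, q⟩ (hx : (T.proj t * σ q : F) ∈ N)
    obtain rfl : q = 1 := by
      rw [← hσ q, QuotientGroup.eq_one_iff, Subgroup.mem_subgroupOf,
        ← M.mul_mem_cancel_left (T.proj t).2]
      exact T.le hx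
    obtain ⟨e, rfl⟩ := T.mem_range_incl t (by simpa using hx)
    exact ⟨e, rfl⟩
  conj_incl x e := by
    obtain ⟨t, q⟩ := x
    simp only [SemidirectProduct.mk_eq_inl_mul_inr, MonoidHom.comp_apply, map_mul,
      SemidirectProduct.lift_inl, SemidirectProduct.lift_inr, mul_smul, Subgroup.coe_mul,
      Subgroup.coe_inclusion, ← T.conj_incl, ← (hβ q).apply_incl, SemidirectProduct.inl_aut,
      map_inv]
    group

theorem nonempty_of_isFreeGroup_quotient (T : Thickening.{u, v, w} E M) [M.Normal]
    {M' : Subgroup F} (hM : M ≤ M') [IsFreeGroup (M' ⧸ M.subgroupOf M')]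
    (h : ∀ f ∈ M', ∃ α : MulAut T.carrier, T.LiftsConj f α) :
    Nonempty (Thickening.{u, v, max w u} E M') := by
  obtain ⟨σ, hσ⟩ := exists_rightInverse_of_isFreeGroup
      (QuotientGroup.mk'_surjective (M.subgroupOf M'))
  obtain ⟨β, hβ⟩ := T.exists_liftsConj_monoidHom (M'.subtype.comp σ) fun q => h _ (σ q).2
  exact ⟨T.semidirect hM hσ hβ⟩

theorem nonempty_self_hom (T : Thickening E ⊤) {θ : F →* T.carrier}
    (hθ : ∀ f, (T.proj (θ f) : F) = f) : Nonempty ((self N).Hom E) := by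
  let s : N →* E.carrier := (MonoidHom.ofInjective T.incl_injective).symm.toMonoidHom.comp
    ((θ.comp N.subtype).codRestrict T.incl.range
      fun n => T.mem_range_incl _ ((hθ n).symm ▸ n.2))
  have incl_s (n : N) : T.incl (s n) = θ n :=
    MonoidHom.apply_ofInjective_symm T.incl_injective _
  exact ⟨{
    toHom := s
    proj_comp := fun (n : N) => Subtype.ext <| by
      change (E.proj (s n) : F) = n
      rw [← T.proj_incl, incl_s, hθ]
    map_smul := fun f (n : N) => T.incl_injective <| by
      change T.incl (s (MulAut.conjNormal f n)) = T.incl (f • s n)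
      have hsmul : T.incl (f • s n) = θ f * T.incl (s n) * (θ f)⁻¹ := by rw [T.conj_incl, hθ]
      rw [hsmul, incl_s, incl_s, MulAut.conjNormal_apply, map_mul, map_mul, map_inv] }⟩

end Thickening

end FCentralExtension

open FCentralExtension in
theorem isAdmissible_of_isFreeGroup_quotient {F : Type u} [Group F] [IsFreeGroup F]
    {N K : Subgroup F} [N.Normal] [K.Normal] (hNK : N ≤ K) [IsFreeGroup (K ⧸ N.subgroupOf K)]
    [IsFreeGroup (F ⧸ K)] : IsAdmissible.{u, w} N := by
  refine isAdmissible_of_nonempty_self_hom fun E => ?_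
  have : IsFreeGroup ((⊤ : Subgroup F) ⧸ K.subgroupOf ⊤) :=
    .ofMulEquiv (QuotientGroup.congr _ K Subgroup.topEquiv
      ((Subgroup.subgroupOf_map_subtype K ⊤).trans (inf_top_eq K))).symm
  obtain ⟨T⟩ := (Thickening.refl E).nonempty_of_isFreeGroup_quotient hNK
    fun f _ => ⟨_, Thickening.liftsConj_refl E f⟩
  obtain ⟨T'⟩ := T.nonempty_of_isFreeGroup_quotient le_top fun f _ => T.exists_liftsConj f
  obtain ⟨θ, hθ⟩ := exists_comp_eq_of_isFreeGroup T'.proj_surjective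
      Subgroup.topEquiv.symm.toMonoidHom
  exact T'.nonempty_self_hom fun f => congrArg Subtype.val (DFunLike.congr_fun hθ f)

namespace UGroup

variable {F : Type u} {G : Type v} [Group F] [Group G]

theorem gen_one : gen (1 : F) = 1 := by simp [gen]

theorem gen_coe (x : {x : F // x ≠ 1}) : gen (x : F) = FreeGroup.of x := by
  simp [gen, x.2]

theorem eval_gen (x : F) : eval F (gen x) = x := by
  by_cases h : x = 1 <;> simp [gen, eval, h]

theorem map_gen (φ : F →* G) (x : F) : map φ (gen x) = gen (φ x) := by
  by_cases h : x = 1 <;> simp [gen, map, h]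

theorem eval_map (φ : F →* G) (v : UGroup F) : eval G (map φ v) = φ (eval F v) := by
  have : (eval G).comp (map φ) = φ.comp (eval F) := by
    ext x
    simp [← gen_coe, map_gen, eval_gen]
  exact DFunLike.congr_fun this v

theorem map_surjective {φ : F →* G} (hφ : Function.Surjective φ) :
    Function.Surjective (map φ) := by
  rw [← MonoidHom.range_eq_top, eq_top_iff, ← FreeGroup.closure_range_of, Subgroup.closure_le]
  rintro _ ⟨x, rfl⟩
  obtain ⟨y, hy⟩ := hφ x
  exact ⟨gen y, by rw [map_gen, hy, gen_coe]⟩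

end UGroup

namespace UPair

variable {F : Type u} [Group F] (N : Subgroup F) [N.Normal]

instance normal : (UPair N).Normal :=
  MonoidHom.normal_ker _

instance isFreeGroup_quotient : IsFreeGroup (UGroup F ⧸ UPair N) :=
  .ofMulEquiv (QuotientGroup.quotientKerEquivOfSurjective _
    (UGroup.map_surjective (QuotientGroup.mk'_surjective N))).symm

theorem eval_mem (k : UPair N) : UGroup.eval F k ∈ N := by
  rw [← QuotientGroup.eq_one_iff, ← QuotientGroup.mk'_apply, ← UGroup.eval_map,
    MonoidHom.mem_ker.1 k.2, map_one]

/-- The evaluation map `U_{N,F} → N`, whose kernel is `J_{N,F}`. -/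
noncomputable def eval : UPair N →* N :=
  ((UGroup.eval F).comp (UPair N).subtype).codRestrict N (eval_mem N)

theorem eval_surjective : Function.Surjective (eval N) := fun n => by
  refine ⟨⟨UGroup.gen n, ?_⟩, Subtype.ext (UGroup.eval_gen _)⟩
  rw [UPair, MonoidHom.mem_ker, UGroup.map_gen, QuotientGroup.mk'_apply,
    (QuotientGroup.eq_one_iff _).2 n.2, UGroup.gen_one]

theorem ker_eval : (eval N).ker = (JPair N).subgroupOf (UPair N) := by
  ext k
  exact Subtype.ext_iff.trans (and_iff_right k.2).symm

end UPair

instance JPair.isFreeGroup_quotient {F : Type u} [Group F] (N : Subgroup F) [N.Normal]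
    [IsFreeGroup N] : IsFreeGroup (UPair N ⧸ (JPair N).subgroupOf (UPair N)) :=
  .ofMulEquiv ((QuotientGroup.quotientMulEquivOfEq (UPair.ker_eval N).symm).trans
    (QuotientGroup.quotientKerEquivOfSurjective _ (UPair.eval_surjective N))).symm

theorem isAdmissible_JPair {U : Type u} [Group U] (R : Subgroup U) [R.Normal] [IsFreeGroup R] :
    IsAdmissible.{u, w} (JPair R) :=
  isAdmissible_of_isFreeGroup_quotient (K := UPair R) inf_le_left

theorem lemma14 :
    (∀ (U : Type u) [Group U] (R : Subgroup U) [R.Normal], IsFreeGroup R →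
      IsAdmissible.{u, w} (JPair R)) ∧
    (∀ (F : Type u) [Group F] (N : Subgroup F) [N.Normal],
      IsAdmissible.{u, w} (JPair (JPair N))) :=
  ⟨fun _ _ R _ _ => isAdmissible_JPair R, fun _ _ N _ => isAdmissible_JPair (JPair N)⟩
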